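/- Let $F$ be a field with $\operatorname{char}(F)\neq 2$ and let $A$ be a central simple $F$-algebra, i.e. a unital associative $F$-algebra, not necessarily finite-dimensional, that is simple as a ring and whose center is $F\cdot 1$. Write $[a,b]=ab-ba$ and let $[A,A]$ be the $F$-linear span of all commutators $[a,b]$ with $a,b\in A$. Suppose that $1\notin[A,A]$. Let $\mathcal D$ be the (associative, not necessarily unital) subalgebra of $\operatorname{End}_F(A)$ generated by all inner derivations $x\mapsto [a,x]$, $a\in A$. Then $\mathcal D$ acts densely on $[A,A]$: every $T\in\mathcal D$ maps $[A,A]$ into itself, and for all $n$, all $F$-linearly independent $x_1,\dots,x_n\in[A,A]$ and all $y_1,\dots,y_n\in[A,A]$ there exists $T\in\mathcal D$ such that $Tx_i=y_i$ for $i=1,\dots,n$. -/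

import Mathlib

/-- `[A, A]`: the `F`-linear span of all commutators `⁅a, b⁆ = a * b - b * a` in `A`. -/
def commutatorSpace (F A : Type*) [Field F] [Ring A] [Algebra F A] : Submodule F A :=
  Submodule.span F {z | ∃ a b : A, ⁅a, b⁆ = z}

/-- The associative, not necessarily unital, subalgebra of `End_F(A)` generated by all inner
derivations `x ↦ ⁅a, x⁆ = a * x - x * a` of `A`. In particular the identity operator is not adjoined. -/
def innerDerivationAlgebra (F A : Type*) [Field F] [Ring A] [Algebra F A] :
    NonUnitalSubalgebra F (Module.End F A) :=
  NonUnitalAlgebra.adjoin F {D | ∃ a : A, D = LinearMap.mulLeft F a - LinearMap.mulRight F a}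

/-- An algebra `𝒜` of linear operators on `V` acts densely on the subspace `X` of `V`:
`X` is invariant under `𝒜`, and every finite linearly independent family in `X` can be sent to any
family in `X` of the same size by an element of `𝒜`. -/
def ActsDenselyOn {F V : Type*} [Field F] [AddCommGroup V] [Module F V]
    (𝒜 : NonUnitalSubalgebra F (Module.End F V)) (X : Submodule F V) : Prop :=
  (∀ T ∈ 𝒜, ∀ x ∈ X, T x ∈ X) ∧
    ∀ (n : ℕ) (x y : Fin n → X), LinearIndependent F x →
      ∃ T ∈ 𝒜, ∀ i : Fin n, T (x i : V) = (y i : V)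

/-!
By the Jacobson density theorem it suffices to know that `[A, A]` is an irreducible module over the
Lie algebra `A` and that its only endomorphisms are the scalars.

*Irreducibility* is Herstein's theorem on Lie ideals `V` of a simple ring. If `⁅u, v⁆ ≠ 0` for some
`u, v ∈ V`, then `{x | ⁅A, x⁆ ⊆ V}` is a subring that contains the ideal generated by `⁅u, v⁆`, so
`[A, A] ⊆ V`. If `V` is abelian, then `⁅v, ⁅v, a⁆⁆ = 0` for all `v ∈ V` and `a ∈ A`, which makes
`v` central; but `[A, A]` has no nonzero central elements, as `1 ∉ [A, A]`.

*Scalar endomorphisms.* If `f` commutes with all inner derivations, then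
`⁅x, ⁅b, f (f x)⁆⁆ = ⁅f x, ⁅b, f x⁆⁆` for all `b ∈ A`. As `A ⊗ Aᵐᵒᵖ` acts faithfully on `A`, this is
an identity between tensors, and contracting it shows that `f x` is a combination of `1` and `x`.
-/

open Module TensorProduct

section Density

variable {F M : Type*} [Field F] [AddCommGroup M] [Module F M]

/-- A set `S` of operators on `M` is absolutely irreducible if the only `S`-invariant subspaces of
`M` are `0` and `M`, and the only operators that commute with `S` are the scalars. For the purposes
of this definition the zero space counts as irreducible. -/
structure IsAbsolutelyIrreducible (S : Set (End F M)) : Prop where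
  eq_bot_or_eq_top (W : Submodule F M) (hW : ∀ T ∈ S, W ∈ T.invtSubmodule) : W = ⊥ ∨ W = ⊤
  exists_eq_smul (f : End F M) (hf : ∀ T ∈ S, Commute f T) : ∃ c : F, ∀ m, f m = c • m

theorem IsAbsolutelyIrreducible.exists_mem_adjoin_forall_mem_finset {S : Set (End F M)}
    (hS : IsAbsolutelyIrreducible S) (g : End F M) (s : Finset M) :
    ∃ T ∈ Algebra.adjoin F S, ∀ m ∈ s, T m = g m := by
  obtain hM | hM := subsingleton_or_nontrivial M
  · exact ⟨0, zero_mem _, fun m _ ↦ Subsingleton.elim _ _⟩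
  let R := Algebra.adjoin F S
  have hsimple : IsSimpleModule R M := by
    have : Nontrivial (Submodule R M) := (Submodule.nontrivial_iff R).2 hM
    refine (isSimpleModule_iff R M).2 ⟨fun N ↦ ?_⟩
    have hN : ∀ T ∈ S, N.restrictScalars F ∈ T.invtSubmodule := fun T hT v hv ↦
      N.smul_mem (⟨T, Algebra.subset_adjoin hT⟩ : R) hv
    exact (hS.eq_bot_or_eq_top _ hN).imp (Submodule.restrictScalars_eq_bot_iff F R M).1
      (Submodule.restrictScalars_eq_top_iff F R M).1
  have hscalar (f : End R M) : ∃ c : F, ∀ m, f m = c • m :=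
    hS.exists_eq_smul (f.restrictScalars F) fun T hT ↦
      LinearMap.ext (f.map_smul (⟨T, Algebra.subset_adjoin hT⟩ : R))
  let g' : End (End R M) M :=
    { toFun := g
      map_add' := g.map_add
      map_smul' := fun f m ↦ by
        obtain ⟨c, hc⟩ := hscalar f
        simp [hc] }
  obtain ⟨T, hT⟩ := jacobson_density (R := R) g' s
  exact ⟨T, T.2, fun m hm ↦ (hT m hm).symm⟩

theorem mul_mem_of_mem_adjoin {E : Type*} [Ring E] [Algebra F E] {𝒜 : NonUnitalSubalgebra F E}
    {S T : E} (hS : S ∈ 𝒜) (hT : T ∈ Algebra.adjoin F (𝒜 : Set E)) : S * T ∈ 𝒜 := by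
  induction hT using Algebra.adjoin_induction generalizing S with
  | mem T hT => exact mul_mem hS hT
  | algebraMap c =>
    rw [← Algebra.commutes, ← Algebra.smul_def]
    exact SMulMemClass.smul_mem c hS
  | add P Q _ _ hP hQ => exact mul_add S P Q ▸ add_mem (hP hS) (hQ hS)
  | mul P Q _ _ hP hQ => exact mul_assoc S P Q ▸ hQ (hP hS)

theorem exists_end_apply_eq_of_linearIndependent {ι : Type*} {x : ι → M}
    (hx : LinearIndependent F x) (y : ι → M) : ∃ g : End F M, ∀ i, g (x i) = y i := by
  obtain ⟨g, hg⟩ := ((Basis.span hx).constr F y).exists_extend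
  refine ⟨g, fun i ↦ ?_⟩
  rw [← (Basis.span hx).constr_basis F y i, ← hg, LinearMap.comp_apply, Submodule.subtype_apply,
    Basis.span_apply]

variable {𝒜 : NonUnitalSubalgebra F (End F M)}

theorem IsAbsolutelyIrreducible.exists_mem_apply_eq
    (h𝒜 : IsAbsolutelyIrreducible (𝒜 : Set (End F M))) {w : M} (hw : ∃ T ∈ 𝒜, T w ≠ 0) (y : M) :
    ∃ T ∈ 𝒜, T w = y := by
  let W : Submodule F M := 𝒜.toSubmodule.map (LinearMap.applyₗ w)
  have hW : ∀ T ∈ 𝒜, W ∈ T.invtSubmodule := by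
    rintro T hT _ ⟨S, hS, rfl⟩
    exact ⟨T * S, 𝒜.mul_mem hT hS, rfl⟩
  have hW0 : W ≠ ⊥ := by
    obtain ⟨T, hT, hTw⟩ := hw
    exact Submodule.ne_bot_iff _ |>.2 ⟨T w, ⟨T, hT, rfl⟩, hTw⟩
  exact ((h𝒜.eq_bot_or_eq_top W hW).resolve_left hW0).ge (Submodule.mem_top (x := y))

/-- The unital density theorem moves the `x i` to multiples of one vector `w`, and composing with
operators in `𝒜` that send `w` to the `y i` leads back into the non-unital algebra `𝒜`. -/
theorem IsAbsolutelyIrreducible.exists_mem_forall_apply_eq {ι : Type*} [Finite ι]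
    (h𝒜 : IsAbsolutelyIrreducible (𝒜 : Set (End F M))) (hann : ∀ m ≠ 0, ∃ T ∈ 𝒜, T m ≠ 0)
    {x : ι → M} (hx : LinearIndependent F x) (y : ι → M) : ∃ T ∈ 𝒜, ∀ i, T (x i) = y i := by
  classical
  have := Fintype.ofFinite ι
  obtain hM | hM := subsingleton_or_nontrivial M
  · exact ⟨0, zero_mem _, fun i ↦ Subsingleton.elim _ _⟩
  obtain ⟨w, hw⟩ := exists_ne (0 : M)
  choose S hS hSw using fun i ↦ h𝒜.exists_mem_apply_eq (hann w hw) (y i)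
  have hP (i : ι) : ∃ P ∈ Algebra.adjoin F (𝒜 : Set (End F M)),
      ∀ j, P (x j) = if j = i then w else 0 := by
    obtain ⟨g, hg⟩ := exists_end_apply_eq_of_linearIndependent hx fun j ↦ if j = i then w else 0
    obtain ⟨P, hP, hPg⟩ := h𝒜.exists_mem_adjoin_forall_mem_finset g (Finset.univ.image x)
    exact ⟨P, hP, fun j ↦ by rw [hPg _ (by simp), hg]⟩
  choose P hP hPx using hP
  refine ⟨∑ i, S i * P i, sum_mem fun i _ ↦ mul_mem_of_mem_adjoin (hS i) (hP i), fun j ↦ ?_⟩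
  simp [hPx, apply_ite, hSw]

/-- The action of an algebra of operators on an invariant subspace `X`. -/
def restrictHom (𝒜 : NonUnitalSubalgebra F (End F M)) (X : Submodule F M)
    (hX : ∀ T ∈ 𝒜, X ∈ T.invtSubmodule) : 𝒜 →ₙₐ[F] End F X where
  toFun T := (T : End F M).restrict (hX T T.2)
  map_smul' _ _ := rfl
  map_zero' := rfl
  map_add' _ _ := rfl
  map_mul' _ _ := rfl

theorem actsDenselyOn_of_isAbsolutelyIrreducible {X : Submodule F M}
    (hX : ∀ T ∈ 𝒜, X ∈ T.invtSubmodule)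
    (hirr : IsAbsolutelyIrreducible (Set.range (restrictHom 𝒜 X hX)))
    (hann : ∀ x ∈ X, x ≠ 0 → ∃ T ∈ 𝒜, T x ≠ 0) : ActsDenselyOn 𝒜 X := by
  refine ⟨hX, fun n x y hx ↦ ?_⟩
  have hann' : ∀ m ≠ 0, ∃ T ∈ NonUnitalAlgHom.range (restrictHom 𝒜 X hX), T m ≠ 0 := fun m hm ↦ by
    obtain ⟨T, hT, hTm⟩ := hann m m.2 (by simpa using hm)
    exact ⟨_, ⟨⟨T, hT⟩, rfl⟩, fun h ↦ hTm (congrArg Subtype.val h)⟩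
  rw [← NonUnitalAlgHom.coe_range] at hirr
  obtain ⟨_, ⟨T, rfl⟩, hT⟩ := hirr.exists_mem_forall_apply_eq hann' hx y
  exact ⟨T, T.2, fun i ↦ congrArg Subtype.val (hT i)⟩

end Density

section SimpleRing

variable {A : Type*} [Ring A] [IsSimpleRing A]

open scoped Pointwise in
theorem addSubgroup_eq_top_of_forall_mul_mul_mem (S : AddSubgroup A) {x : A} (hx : x ≠ 0)
    (h : ∀ a b, a * x * b ∈ S) : S = ⊤ := by
  have hspan : TwoSidedIdeal.span {x} = ⊤ :=
    (eq_bot_or_eq_top _).resolve_left fun hbot ↦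
      hx ((TwoSidedIdeal.mem_bot A).1 (hbot ▸ TwoSidedIdeal.subset_span rfl))
  refine (AddSubgroup.eq_top_iff' S).2 fun z ↦ ?_
  have hz : z ∈ AddSubgroup.closure (Set.univ * {x} * Set.univ) :=
    TwoSidedIdeal.mem_span_iff_mem_addSubgroup_closure.1 (hspan ▸ trivial)
  refine (AddSubgroup.closure_le S).2 ?_ hz
  rintro _ ⟨_, ⟨a, -, _, rfl, rfl⟩, b, -, rfl⟩
  exact h a b

theorem eq_zero_of_forall_mul_mul_eq_zero {x y : A} (hx : x ≠ 0) (h : ∀ c, x * c * y = 0) :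
    y = 0 := by
  have hker : (AddMonoidHom.mulRight y).ker = ⊤ :=
    addSubgroup_eq_top_of_forall_mul_mul_mem _ hx fun a b ↦ by
      simp [AddMonoidHom.mem_ker, mul_assoc a, h]
  simpa using (hker ▸ AddSubgroup.mem_top (1 : A) : (1 : A) ∈ (AddMonoidHom.mulRight y).ker)

theorem lie_eq_zero_of_forall_lie_lie_eq_zero (h2 : (2 : A) ≠ 0) {v : A}
    (h : ∀ a : A, ⁅v, ⁅v, a⁆⁆ = 0) (a : A) : ⁅v, a⁆ = 0 := by
  -- Expand `D (D (a * b))` for the derivation `D = ⁅v, ·⁆`, which satisfies `D ∘ D = 0`.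
  have hmul (a b : A) : ⁅v, a⁆ * ⁅v, b⁆ = 0 := by
    refine eq_zero_of_forall_mul_mul_eq_zero h2 fun c ↦ ?_
    calc 2 * c * (⁅v, a⁆ * ⁅v, b⁆)
        = c * (⁅v, ⁅v, a * b⁆⁆ - ⁅v, ⁅v, a⁆⁆ * b - a * ⁅v, ⁅v, b⁆⁆) := by
          simp only [Ring.lie_def]; noncomm_ring
      _ = 0 := by simp [h]
  by_contra ha
  refine ha (eq_zero_of_forall_mul_mul_eq_zero ha fun c ↦ ?_)
  calc ⁅v, a⁆ * c * ⁅v, a⁆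
      = ⁅v, a⁆ * ⁅v, c * a⁆ - ⁅v, a⁆ * ⁅v, c⁆ * a := by
        simp only [Ring.lie_def]; noncomm_ring
    _ = 0 := by simp [hmul]

end SimpleRing

section LieIdeals

attribute [local instance] LieRing.ofAssociativeRing

section Herstein

variable {R A : Type*} [CommRing R] [Ring A] [Algebra R A] {V : LieIdeal R A}

theorem mul_mem_normalizer {x y : A} (hx : x ∈ V.normalizer) (hy : y ∈ V.normalizer) :
    x * y ∈ V.normalizer := fun a ↦ by
  have e : ⁅a, x * y⁆ = ⁅y * a, x⁆ + ⁅a * x, y⁆ := by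
    simp only [Ring.lie_def]; noncomm_ring
  exact e ▸ V.add_mem (hx _) (hy _)

theorem lie_mul_mem_normalizer {u v : A} (hu : u ∈ V) (hv : v ∈ V) (a : A) :
    ⁅u, v⁆ * a ∈ V.normalizer := by
  have hV := V.le_normalizer
  have e : ⁅u, v⁆ * a = -⁅v * a, u⁆ + v * ⁅a, u⁆ := by
    simp only [Ring.lie_def]; noncomm_ring
  exact e ▸ add_mem (neg_mem (hV (V.lie_mem hu))) (mul_mem_normalizer (hV hv) (hV (V.lie_mem hu)))

theorem mul_lie_mul_mem_normalizer {u v : A} (hu : u ∈ V) (hv : v ∈ V) (a b : A) :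
    a * ⁅u, v⁆ * b ∈ V.normalizer := by
  have e : a * ⁅u, v⁆ * b = ⁅a, ⁅u, v⁆ * b⁆ + ⁅u, v⁆ * (b * a) := by
    simp only [Ring.lie_def]; noncomm_ring
  exact e ▸ add_mem (V.normalizer.lie_mem (lie_mul_mem_normalizer hu hv b))
    (lie_mul_mem_normalizer hu hv (b * a))

theorem le_center_or_lie_top_top_le [IsSimpleRing A] (h2 : (2 : A) ≠ 0) (V : LieIdeal R A) :
    V ≤ LieAlgebra.center R A ∨ ⁅(⊤ : LieIdeal R A), (⊤ : LieIdeal R A)⁆ ≤ V := by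
  by_cases habel : ∀ u ∈ V, ∀ v ∈ V, ⁅u, v⁆ = 0
  · refine .inl fun v hv a ↦ ?_
    rw [← lie_skew, neg_eq_zero]
    exact lie_eq_zero_of_forall_lie_lie_eq_zero h2
      (fun a ↦ habel v hv _ (lie_mem_left R A V v a hv)) a
  · push Not at habel
    obtain ⟨u, hu, v, hv, huv⟩ := habel
    have htop : V.normalizer.toSubmodule.toAddSubgroup = ⊤ :=
      addSubgroup_eq_top_of_forall_mul_mul_mem _ huv (mul_lie_mul_mem_normalizer hu hv)
    exact .inr ((LieSubmodule.top_lie_le_iff_le_normalizer _ _).2 fun x _ ↦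
      (htop ▸ AddSubgroup.mem_top x : x ∈ V.normalizer.toSubmodule.toAddSubgroup))

end Herstein

section CentralSimple

variable {F A : Type*} [Field F] [Ring A] [Algebra F A] [Algebra.IsCentral F A]

theorem exists_eq_algebraMap_of_forall_commute {x : A} (h : ∀ a, Commute a x) :
    ∃ c : F, x = algebraMap F A c :=
  (Algebra.IsCentral.mem_center_iff F).1 (Subalgebra.mem_center_iff.2 h)

theorem disjoint_center_of_one_notMem {V : LieIdeal F A} (hV : (1 : A) ∉ V) :
    Disjoint V (LieAlgebra.center F A) := by
  refine disjoint_iff_inf_le.2 fun x ⟨hxV, hx⟩ ↦ (LieSubmodule.mem_bot x).2 ?_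
  obtain ⟨c, rfl⟩ := exists_eq_algebraMap_of_forall_commute (F := F) fun a ↦
    commute_iff_lie_eq.2 (hx a)
  by_contra hc
  rw [Algebra.algebraMap_eq_smul_one] at hxV hc
  exact hV ((V.toSubmodule.smul_mem_iff (left_ne_zero_of_smul hc)).1 hxV)

variable [IsSimpleRing A]

variable (F A) in
theorem isAbsolutelyIrreducible_range_mulLeftRight :
    IsAbsolutelyIrreducible ((AlgHom.mulLeftRight F A).range : Set (End F A)) where
  eq_bot_or_eq_top W hW := by
    refine or_iff_not_imp_left.2 fun hW0 ↦ ?_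
    obtain ⟨w, hw, hw0⟩ := W.exists_mem_ne_zero_of_ne_bot hW0
    refine Submodule.toAddSubgroup_injective
      (addSubgroup_eq_top_of_forall_mul_mul_mem W.toAddSubgroup hw0 fun a b ↦ ?_)
    simpa using hW _ ⟨a ⊗ₜ MulOpposite.op b, rfl⟩ hw
  exists_eq_smul f hf := by
    have hmul (a v b : A) : f (a * v * b) = a * f v * b := by
      simpa using LinearMap.congr_fun (hf _ ⟨a ⊗ₜ MulOpposite.op b, rfl⟩) v
    obtain ⟨c, hc⟩ := exists_eq_algebraMap_of_forall_commute (F := F) (x := f 1) fun a ↦ by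
      rw [commute_iff_eq, ← mul_one (a * f 1), ← hmul, ← one_mul (f 1), ← hmul]
      simp
    refine ⟨c, fun v ↦ ?_⟩
    simpa [hc, Algebra.smul_def] using hmul 1 1 v

/-- Density of the multiplication algebra of `A` provides an operator that is the identity on one of
the linearly independent right-hand factors of a tensor and kills the others. -/
theorem mulLeftRight_injective : Function.Injective (AlgHom.mulLeftRight F A) := by
  classical
  refine (injective_iff_map_eq_zero _).2 fun t ht ↦ ?_
  let ℬ := Basis.ofVectorSpace F Aᵐᵒᵖ
  obtain ⟨a, rfl⟩ := eq_repr_basis_right ℬ t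
  have hsum (b : A) : ∑ j ∈ a.support, a j * b * (ℬ j).unop = 0 := by
    simpa [Finsupp.sum] using LinearMap.congr_fun ht b
  have hmul (r : A ⊗[F] Aᵐᵒᵖ) :
      ∑ j ∈ a.support, a j * AlgHom.mulLeftRight F A r (ℬ j).unop = 0 := by
    induction r with
    | zero => simp
    | tmul p q => simpa [Finset.sum_mul, mul_assoc] using congrArg (· * q.unop) (hsum p)
    | add r s hr hs => simp [mul_add, Finset.sum_add_distrib, hr, hs]
  suffices a = 0 by simp [this]
  ext i
  obtain ⟨T, hT, hTi⟩ :=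
    (isAbsolutelyIrreducible_range_mulLeftRight F A).exists_mem_adjoin_forall_mem_finset
      ((ℬ.coord i ∘ₗ (MulOpposite.opLinearEquiv F).toLinearMap).smulRight 1)
      (a.support.image fun j ↦ (ℬ j).unop)
  rw [Algebra.adjoin_eq] at hT
  obtain ⟨r, rfl⟩ := hT
  have hTj : ∀ j ∈ a.support,
      AlgHom.mulLeftRight F A r (ℬ j).unop = if j = i then 1 else 0 := fun j hj ↦ by
    simpa [Finsupp.single_apply] using hTi _ (Finset.mem_image_of_mem _ hj)
  calc a i = ∑ j ∈ a.support, a j * if j = i then 1 else 0 := by simp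
    _ = ∑ j ∈ a.support, a j * AlgHom.mulLeftRight F A r (ℬ j).unop :=
      Finset.sum_congr rfl fun j hj ↦ by rw [hTj j hj]
    _ = 0 := hmul r

theorem mem_span_one_pair_of_forall_lie_lie_eq (h2 : (2 : F) ≠ 0) {x y z : A}
    (h : ∀ b : A, ⁅x, ⁅b, y⁆⁆ = ⁅z, ⁅b, z⁆⁆) : z ∈ Submodule.span F {1, x} := by
  by_contra hz
  obtain ⟨φ, hφz, hker⟩ := Submodule.exists_le_ker_of_notMem hz
  have hφ1 : φ 1 = 0 := hker (Submodule.subset_span (by simp))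
  have hφx : φ x = 0 := hker (Submodule.subset_span (by simp))
  let op := MulOpposite.op (α := A)
  have htensor : x ⊗ₜ[F] op y + y ⊗ₜ op x - (x * y) ⊗ₜ op 1 - 1 ⊗ₜ op (y * x) =
      (2 : F) • z ⊗ₜ op z - (z * z) ⊗ₜ op 1 - 1 ⊗ₜ op (z * z) := by
    refine mulLeftRight_injective (LinearMap.ext fun b ↦ ?_)
    have hexpand : x * b * y + y * b * x - x * y * b - b * (y * x) -
        ((2 : F) • (z * b * z) - z * z * b - b * (z * z)) = ⁅x, ⁅b, y⁆⁆ - ⁅z, ⁅b, z⁆⁆ := by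
      rw [two_smul]
      simp only [Ring.lie_def]
      noncomm_ring
    rw [h b, sub_self, sub_eq_zero] at hexpand
    simpa [op] using hexpand
  have hcontract : φ y • x - φ (y * x) • 1 = (2 * φ z) • z - φ (z * z) • 1 := by
    simpa [op, hφ1, hφx, mul_smul] using
      congrArg ((TensorProduct.rid F A).toLinearMap ∘ₗ
        (φ ∘ₗ (MulOpposite.opLinearEquiv F).symm.toLinearMap).lTensor A) htensor
  refine hz (((Submodule.span F {1, x}).smul_mem_iff (mul_ne_zero h2 hφz)).1 ?_)
  rw [← sub_add_cancel ((2 * φ z) • z) (φ (z * z) • 1), ← hcontract]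
  exact Submodule.mem_span_pair.2 ⟨φ (z * z) - φ (y * x), φ y, by module⟩

theorem exists_eq_smul_of_lieModuleHom (h2 : (2 : F) ≠ 0) {V : LieIdeal F A} (hV : (1 : A) ∉ V)
    (f : V →ₗ⁅F,A⁆ V) : ∃ c : F, ∀ x, f x = c • x := by
  refine (LinearMap.exists_eq_smul_id_of_forall_notLinearIndependent
    (f := (f : V →ₗ[F] V)) fun x ↦ ?_).imp fun c hc x ↦ LinearMap.congr_fun hc x
  have hlie (a : A) (x : V) : (f ⁅a, x⁆ : A) = ⁅a, (f x : A)⁆ := by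
    rw [f.map_lie, LieSubmodule.coe_bracket]
  have hswap (x u : V) : ⁅(x : A), (f u : A)⁆ = ⁅(f x : A), (u : A)⁆ := by
    have hxu : ⁅(x : A), u⁆ = -⁅(u : A), x⁆ := by
      ext
      simp
    rw [← hlie, hxu, map_neg, LieSubmodule.coe_neg, hlie, lie_skew]
  have hspan : (f x : A) ∈ Submodule.span F {1, (x : A)} :=
    mem_span_one_pair_of_forall_lie_lie_eq h2 (y := (f (f x) : A)) fun b ↦ by
      rw [← hlie, hswap, LieSubmodule.coe_bracket]
  obtain ⟨p, q, hpq⟩ := Submodule.mem_span_pair.1 hspan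
  have hp : p = 0 := by
    by_contra hp
    refine hV ((V.toSubmodule.smul_mem_iff hp).1 ?_)
    rw [eq_sub_of_add_eq hpq]
    exact sub_mem (f x).2 (V.smul_mem q x.2)
  intro hli
  have hdep : q • x + (-1 : F) • f x = 0 := by
    ext
    simp [← hpq, hp]
  exact one_ne_zero (neg_eq_zero.1 (LinearIndependent.pair_iff.1 hli q (-1) hdep).2)

end CentralSimple

section InnerDerivations

variable {F A : Type*} [Field F] [Ring A] [Algebra F A]

theorem commutatorSpace_eq_lie_top_top :
    commutatorSpace F A = ⁅(⊤ : LieIdeal F A), (⊤ : LieIdeal F A)⁆.toSubmodule := by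
  rw [LieSubmodule.lieIdeal_oper_eq_linear_span']
  simp [commutatorSpace]

theorem innerDerivation_mem_innerDerivationAlgebra (a : A) :
    LinearMap.mulLeft F a - LinearMap.mulRight F a ∈ innerDerivationAlgebra F A :=
  NonUnitalAlgebra.subset_adjoin F ⟨a, rfl⟩

theorem lieIdeal_mem_invtSubmodule (V : LieIdeal F A) :
    ∀ T ∈ innerDerivationAlgebra F A, V.toSubmodule ∈ T.invtSubmodule := by
  intro T hT
  induction hT using NonUnitalAlgebra.adjoin_induction with
  | mem T hT =>
    obtain ⟨a, rfl⟩ := hT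
    exact fun v hv ↦ V.lie_mem (x := a) hv
  | add _ _ _ _ hS hT => exact fun v hv ↦ V.add_mem (hS hv) (hT hv)
  | zero => exact fun v _ ↦ V.zero_mem
  | mul _ _ _ _ hS hT => exact fun v hv ↦ hS (hT hv)
  | smul c _ _ hT => exact fun v hv ↦ V.smul_mem c (hT hv)

theorem isAbsolutelyIrreducible_of_le_lie_top_top [Algebra.IsCentral F A] [IsSimpleRing A]
    (h2 : (2 : F) ≠ 0) {V : LieIdeal F A} (hV : (1 : A) ∉ V)
    (hle : V ≤ ⁅(⊤ : LieIdeal F A), (⊤ : LieIdeal F A)⁆) :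
    IsAbsolutelyIrreducible (Set.range (restrictHom (innerDerivationAlgebra F A) V.toSubmodule
      (lieIdeal_mem_invtSubmodule V))) where
  eq_bot_or_eq_top W hW := by
    let W' : LieIdeal F A :=
      { W.map V.toSubmodule.subtype with
        lie_mem := by
          rintro a _ ⟨w, hw, rfl⟩
          exact ⟨_, hW _ ⟨⟨_, innerDerivation_mem_innerDerivationAlgebra a⟩, rfl⟩ hw, rfl⟩ }
    have hW'V : W' ≤ V := Submodule.map_subtype_le _ _
    have h2A : (2 : A) ≠ 0 := by
      rw [← map_ofNat (algebraMap F A) 2]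
      exact (map_ne_zero_iff _ (algebraMap F A).injective).2 h2
    refine (le_center_or_lie_top_top_le h2A W').imp (fun hcenter ↦ ?_) fun hcomm ↦ ?_
    · have hbot : W' = ⊥ :=
        disjoint_self.1 ((disjoint_center_of_one_notMem hV).mono hW'V hcenter)
      refine (Submodule.eq_bot_iff W).2 fun w hw ↦ Subtype.ext ?_
      have hwW' : (w : A) ∈ W' := ⟨w, hw, rfl⟩
      rw [hbot] at hwW'
      exact (LieSubmodule.mem_bot _).1 hwW'
    · refine Submodule.eq_top_iff'.2 fun v ↦ ?_
      obtain ⟨w, hw, hwv⟩ := (hle.trans hcomm) v.2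
      exact (Subtype.ext hwv : w = v) ▸ hw
  exists_eq_smul f hf :=
    exists_eq_smul_of_lieModuleHom h2 hV
      { f with
        map_lie' := fun {a x} ↦ LinearMap.congr_fun
          (hf _ ⟨⟨_, innerDerivation_mem_innerDerivationAlgebra a⟩, rfl⟩) x }

theorem actsDenselyOn_of_le_lie_top_top [Algebra.IsCentral F A] [IsSimpleRing A]
    (h2 : (2 : F) ≠ 0) {V : LieIdeal F A} (hV : (1 : A) ∉ V)
    (hle : V ≤ ⁅(⊤ : LieIdeal F A), (⊤ : LieIdeal F A)⁆) :
    ActsDenselyOn (innerDerivationAlgebra F A) V.toSubmodule := by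
  refine actsDenselyOn_of_isAbsolutelyIrreducible _
    (isAbsolutelyIrreducible_of_le_lie_top_top h2 hV hle) fun x hx hx0 ↦ ?_
  contrapose! hx0
  exact (LieSubmodule.mem_bot x).1 ((disjoint_center_of_one_notMem hV).le_bot
    ⟨hx, fun a ↦ hx0 _ (innerDerivation_mem_innerDerivationAlgebra a)⟩)

end InnerDerivations

end LieIdeals

theorem corollary3p5 {F A : Type*} [Field F] [Ring A] [Algebra F A]
    [Algebra.IsCentral F A] [IsSimpleRing A]
    (hF : ringChar F ≠ 2)
    (h1 : (1 : A) ∉ commutatorSpace F A) :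
    ActsDenselyOn (innerDerivationAlgebra F A) (commutatorSpace F A) := by
  rw [commutatorSpace_eq_lie_top_top] at h1 ⊢
  exact actsDenselyOn_of_le_lie_top_top (Ring.two_ne_zero hF) h1 le_rfl
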